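/- For $n\ge 0$ and a permutation $\tau$ of $\{1,2,3\}$, let $\mathcal S_n(\tau)$ be the set of permutations $\sigma$ of $\{1,\dots,n\}$ that avoid $\tau$, i.e. for which there are no positions $i_1<i_2<i_3$ such that, for all $j,k\in\{1,2,3\}$, $\sigma_{i_j}<\sigma_{i_k}$ if and only if $\tau_j<\tau_k$. Let $\mathrm{fp}(\sigma)$ be the number of fixed points of $\sigma$. For $q>0$ let $\mathbb P_n^{q,\tau}$ be the probability measure on $\mathcal S_n(\tau)$ that gives $\sigma$ the probability $$\frac{q^{\mathrm{fp}(\sigma)}}{Z_n(q,\tau)},\qquad Z_n(q,\tau)=\sum_{\sigma\in\mathcal S_n(\tau)}q^{\mathrm{fp}(\sigma)} .$$ For a positive integer $r$ and $p\in(0,1)$, the distribution $\mathrm{NegativeBinomial}(r,p)$ on $\{0,1,2,\dots\}$ has probability mass function $k\mapsto\binom{k+r-1}{k}(1-p)^k p^r$. **Theorem.** Let $q\in(0,3)$ and $\tau\in\{132,321,213\}$ (in one-line notation). If $\Pi_n$ is a random permutation with distribution $\mathbb P_n^{q,\tau}$, then, as $n\to\infty$, the random variable $\mathrm{fp}(\Pi_n)$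 converges in distribution, without any scaling, to $\mathrm{NegativeBinomial}\left(2,1-\frac q3\right)$. -/

import Mathlib

namespace FixedPointBiased

/-- `σ` contains `τ` as a pattern: there are positions `i₁ < ⋯ < i_m` (the values of a strictly
increasing map `i`) at which the entries of `σ` are in the same relative order as the entries
of `τ`. Permutations of `{1, …, n}` are modelled as permutations of `Fin n = {0, …, n - 1}`. -/
def ContainsPattern {n m : ℕ} (σ : Equiv.Perm (Fin n)) (τ : Equiv.Perm (Fin m)) : Prop :=
  ∃ i : Fin m → Fin n, StrictMono i ∧ ∀ j k : Fin m, σ (i j) < σ (i k) ↔ τ j < τ k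

/-- The set `S_n(τ)` of permutations of size `n` that avoid `τ`. -/
def AvoidingPerm (n : ℕ) {m : ℕ} (τ : Equiv.Perm (Fin m)) : Type :=
  {σ : Equiv.Perm (Fin n) // ¬ ContainsPattern σ τ}

noncomputable instance instFintypeAvoidingPerm (n : ℕ) {m : ℕ} (τ : Equiv.Perm (Fin m)) :
    Fintype (AvoidingPerm n τ) :=
  @Fintype.ofFinite _ (inferInstanceAs (Finite {σ : Equiv.Perm (Fin n) // ¬ ContainsPattern σ τ}))

/-- Every set of permutations is measurable. -/
instance instMeasurableSpaceAvoidingPerm (n : ℕ) {m : ℕ} (τ : Equiv.Perm (Fin m)) :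
    MeasurableSpace (AvoidingPerm n τ) := ⊤

/-- The number of fixed points of a permutation. -/
def fp {n : ℕ} (σ : Equiv.Perm (Fin n)) : ℕ :=
  (Finset.univ.filter fun i : Fin n => σ i = i).card

/-- The normalization constant `Z_n(q, τ)`. -/
noncomputable def normalization (n : ℕ) (q : ℝ) {m : ℕ} (τ : Equiv.Perm (Fin m)) : ℝ :=
  ∑ σ : AvoidingPerm n τ, q ^ fp σ.1

theorem nonempty_avoidingPerm (n : ℕ) {m : ℕ} (hm : 2 ≤ m) (τ : Equiv.Perm (Fin m)) :
    Nonempty (AvoidingPerm n τ) := by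
  have h01 : (⟨0, by omega⟩ : Fin m) < ⟨1, by omega⟩ := by simp [Fin.lt_def]
  by_cases h : τ ⟨0, by omega⟩ < τ ⟨1, by omega⟩
  · refine ⟨⟨Fin.revPerm, ?_⟩⟩
    rintro ⟨i, hi, hc⟩
    have h1 := (hc _ _).2 h
    have h2 := hi h01
    rw [Fin.revPerm_apply, Fin.revPerm_apply, Fin.rev_lt_rev] at h1
    exact absurd h1 (not_lt.2 h2.le)
  · refine ⟨⟨1, ?_⟩⟩
    rintro ⟨i, hi, hc⟩
    exact h ((hc _ _).1 (hi h01))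

theorem normalization_pos (n : ℕ) {q : ℝ} (hq : 0 < q) {m : ℕ} (hm : 2 ≤ m)
    (τ : Equiv.Perm (Fin m)) : 0 < normalization n q τ := by
  have := nonempty_avoidingPerm n hm τ
  exact Finset.sum_pos (fun σ _ => pow_pos hq _) Finset.univ_nonempty

/-- The fixed point biased distribution on `S_n(τ)`: the permutation `σ` has probability
`q ^ fp σ / Z_n(q, τ)`. -/
noncomputable def biasedPMF (n : ℕ) (q : ℝ) (hq : 0 < q) {m : ℕ} (hm : 2 ≤ m)
    (τ : Equiv.Perm (Fin m)) : PMF (AvoidingPerm n τ) :=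
  PMF.ofFintype (fun σ => ENNReal.ofReal (q ^ fp σ.1 / normalization n q τ)) (by
    have hZ := normalization_pos n hq hm τ
    rw [← ENNReal.ofReal_sum_of_nonneg (fun σ _ => div_nonneg (pow_nonneg hq.le _) hZ.le),
      ← Finset.sum_div]
    change ENNReal.ofReal (normalization n q τ / normalization n q τ) = 1
    rw [div_self hZ.ne', ENNReal.ofReal_one])

theorem hasSum_negativeBinomial {r : ℕ} (hr : 1 ≤ r) {p : ℝ} (hp0 : 0 < p) (hp1 : p < 1) :
    HasSum (fun k : ℕ => ((k + r - 1).choose k : ℝ) * (1 - p) ^ k * p ^ r) 1 := by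
  obtain ⟨s, rfl⟩ : ∃ s, r = s + 1 := ⟨r - 1, by omega⟩
  have hn : ‖1 - p‖ < 1 := by rw [Real.norm_eq_abs, abs_lt]; constructor <;> linarith
  have h := (hasSum_choose_mul_geometric_of_norm_lt_one s hn).mul_right (p ^ (s + 1))
  rw [sub_sub_cancel, one_div_mul_cancel (pow_pos hp0 _).ne'] at h
  have he : (fun k : ℕ => ((k + (s + 1) - 1).choose k : ℝ) * (1 - p) ^ k * p ^ (s + 1)) =
      fun k : ℕ => ((k + s).choose s : ℝ) * (1 - p) ^ k * p ^ (s + 1) := by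
    funext k
    rw [show k + (s + 1) - 1 = k + s by omega, Nat.choose_symm_add]
  rw [he]
  exact h

/-- The `NegativeBinomial(r, p)` distribution on `{0, 1, 2, …}`, for a positive integer `r`
and `p ∈ (0, 1)`. -/
noncomputable def negativeBinomialPMF (r : ℕ) (hr : 1 ≤ r) (p : ℝ) (hp0 : 0 < p) (hp1 : p < 1) :
    PMF ℕ :=
  ⟨fun k => ENNReal.ofReal (((k + r - 1).choose k : ℝ) * (1 - p) ^ k * p ^ r), by
    have h := hasSum_negativeBinomial hr hp0 hp1
    have h0 : ∀ k : ℕ, 0 ≤ ((k + r - 1).choose k : ℝ) * (1 - p) ^ k * p ^ r := fun k =>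
      mul_nonneg (mul_nonneg (Nat.cast_nonneg _) (pow_nonneg (by linarith) _))
        (pow_nonneg hp0.le _)
    have h1 := ENNReal.ofReal_tsum_of_nonneg h0 h.summable
    rw [h.tsum_eq, ENNReal.ofReal_one] at h1
    rw [h1]
    exact ENNReal.summable.hasSum⟩

/-- The pattern `132` (one-line notation, entries shifted to `{0, 1, 2}`). -/
def pattern132 : Equiv.Perm (Fin 3) := ⟨![0, 2, 1], ![0, 2, 1], by decide, by decide⟩

/-- The pattern `321`. -/
def pattern321 : Equiv.Perm (Fin 3) := ⟨![2, 1, 0], ![2, 1, 0], by decide, by decide⟩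

/-- The pattern `213`. -/
def pattern213 : Equiv.Perm (Fin 3) := ⟨![1, 0, 2], ![1, 0, 2], by decide, by decide⟩

end FixedPointBiased

/-! ### Ballot numbers and the Catalan convolution recurrence. -/

namespace FixedPointBiased
open Finset Filter Topology PowerSeries

/-! For each of the three patterns the series `F = ∑ₙ xⁿ ∑_σ u ^ fp σ` satisfies `F = C + (u - 1) x
C F`, where `C` is the Catalan series. Expanding geometrically gives `∑ₖ (u - 1)ᵏ xᵏ Cᵏ⁺¹`, whose
coefficients are the ballot numbers (`eq_sum_ballot_of_recurrence`, `HasBallotExpansion`).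

For `321`, a fixed point splits an avoider into two independent avoiders, and marking one fixed
point produces the factor `u - 1` (`fixPoly_succ`). For `132`, splitting at the maximum moves the
blocks off the main diagonal, so all diagonals are treated together; the recursion has an explicit
solution because at most one of the maximum and the two blocks can contribute a correction to the
Catalan count (`eq_catalan_add_catalanTail`). The reverse complement carries `132` to `213` and
preserves fixed points.

The ballot number of index `k`, divided by the `n`-th Catalan number, tends to `(k + 1) / 2ᵏ` and
never exceeds it. Dominated convergence gives `Zₙ / Catₙ → ∑ (k + 1) ((q - 1) / 2)ᵏ = 4 / (3 - q)²`,
while the proportion of avoiders with `k` fixed points tends to `(4 / 9) (k + 1) / 3ᵏ`. The quotient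
of these limits, times `qᵏ`, is the negative binomial mass. Fatou's lemma and the open-set criterion
turn convergence of masses into convergence in distribution. -/

/-- The ballot numbers, as coefficients of the powers of the Catalan series. -/
noncomputable def ballot (e k : ℕ) : ℕ := coeff e (catalanSeries ^ (k + 1))

theorem ballot_zero_left (k : ℕ) : ballot 0 k = 1 := by
  simp [ballot]

theorem ballot_zero_right (e : ℕ) : ballot e 0 = catalan e := by
  simp [ballot]

theorem ballot_succ_zero (e : ℕ) : ballot (e + 1) 0 = ballot e 1 := by
  have h := congrArg (coeff (e + 1)) catalanSeries_sq_mul_X_add_one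
  simp only [map_add, coeff_succ_mul_X, coeff_one] at h
  simp [ballot, ← h]

/-- Multiply `C = 1 + x C²` by `Cᵏ⁺¹` and compare coefficients. -/
theorem ballot_succ_succ (e k : ℕ) :
    ballot (e + 1) (k + 1) = ballot (e + 1) k + ballot e (k + 2) := by
  have h : catalanSeries ^ (k + 1 + 1) =
      catalanSeries ^ (k + 2 + 1) * X + catalanSeries ^ (k + 1) := by
    calc catalanSeries ^ (k + 1 + 1)
        = catalanSeries ^ (k + 1) * (catalanSeries ^ 2 * X + 1) := by
          rw [catalanSeries_sq_mul_X_add_one, pow_succ]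
      _ = _ := by ring
  simp only [ballot]
  rw [h, map_add, coeff_succ_mul_X, add_comm]

/-- The reflection formula, written additively to avoid subtraction in `ℕ`. Pascal's rule makes the
difference of binomials obey the recursion of the ballot numbers. -/
theorem ballot_succ_add_choose (e k : ℕ) :
    ballot (e + 1) k + (2 * e + 2 + k).choose e = (2 * e + 2 + k).choose (e + 1) := by
  induction e generalizing k with
  | zero =>
    induction k with
    | zero => simp [ballot_succ_zero, ballot_zero_left]
    | succ k ih =>
      rw [ballot_succ_succ, ballot_zero_left]
      simp at ih ⊢
      omega
  | succ e ihe =>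
    induction k with
    | zero =>
      have h := ihe 1
      rw [ballot_succ_zero]
      have h1 := Nat.choose_succ_succ (2 * e + 3) e
      have h2 := Nat.choose_succ_succ (2 * e + 3) (e + 1)
      have h3 := Nat.choose_symm_of_eq_add (n := 2 * e + 3) (a := e + 1) (b := e + 2) (by omega)
      simp only [Nat.succ_eq_add_one, show 2 * (e + 1) + 2 + 0 = 2 * e + 3 + 1 by ring, add_zero,
        show 2 * e + 2 + 1 = 2 * e + 3 by ring, show e + 1 + 1 = e + 2 by ring] at *
      omega
    | succ k ihk =>
      have h := ihe (k + 2)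
      rw [ballot_succ_succ]
      have h1 := Nat.choose_succ_succ (2 * e + 4 + k) e
      have h2 := Nat.choose_succ_succ (2 * e + 4 + k) (e + 1)
      simp only [Nat.succ_eq_add_one, show 2 * (e + 1) + 2 + (k + 1) = 2 * e + 4 + k + 1 by ring,
        show 2 * (e + 1) + 2 + k = 2 * e + 4 + k by ring,
        show 2 * e + 2 + (k + 2) = 2 * e + 4 + k by ring, show e + 1 + 1 = e + 2 by ring] at *
      omega

theorem mul_ballot (e k : ℕ) :
    (e + k + 1) * ballot e k = (k + 1) * (2 * e + k).choose e := by
  cases e with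
  | zero => simp [ballot_zero_left]
  | succ e =>
    have h := ballot_succ_add_choose e k
    have h1 := Nat.choose_succ_right_eq (2 * e + 2 + k) e
    rw [show 2 * e + 2 + k - e = e + 1 + k + 1 by omega] at h1
    rw [show 2 * (e + 1) + k = 2 * e + 2 + k by ring]
    zify at h h1 ⊢
    linear_combination (e + 1 + k + 1 : ℤ) * h + h1

/-- The ballot recursion telescopes. This is the sum over first values in the count of
`321`-avoiders. -/
theorem sum_Ico_ballot (n k : ℕ) (hk : k ≤ n) :
    ∑ v ∈ Ico k (n + 1), ballot (n - v) v = ballot (n - k) (k + 1) := by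
  induction hk using Nat.decreasingInduction with
  | self => simp [ballot_zero_left]
  | of_succ k hk ih =>
    rw [Finset.sum_eq_sum_Ico_succ_bot (by omega), ih]
    obtain ⟨e, rfl⟩ : ∃ e, n = k + 1 + e := ⟨n - (k + 1), by omega⟩
    rw [show k + 1 + e - k = e + 1 by omega, show k + 1 + e - (k + 1) = e by omega,
      ballot_succ_succ]

/-- A sequence satisfying the convolution recurrence attached to
`F = C + w X C F`, where `C` is the Catalan series, is a combination of ballot numbers. -/
theorem eq_sum_ballot_of_recurrence {R : Type*} [CommRing R] (w : R) (p : ℕ → R)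
    (h0 : p 0 = 1)
    (hp : ∀ n, p (n + 1) = catalan (n + 1) +
      w * ∑ x ∈ antidiagonal n, (catalan x.1 : R) * p x.2) (n : ℕ) :
    p n = ∑ k ∈ range (n + 1), w ^ k * ballot (n - k) k := by
  set c : R⟦X⟧ := catalanSeries.map (Nat.castRingHom R) with hc
  have hcoeff : ∀ e k, coeff e (c ^ (k + 1)) = (ballot e k : R) := by
    intro e k
    rw [hc, ← map_pow, coeff_map, ballot]
    simp
  have hF : PowerSeries.mk p = c + PowerSeries.C w * c * PowerSeries.mk p * X := by
    ext m
    cases m with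
    | zero =>
      rw [map_add, coeff_zero_mul_X, coeff_mk, h0, hc, coeff_map]
      simp
    | succ m =>
      rw [map_add, coeff_succ_mul_X, mul_assoc, coeff_C_mul, coeff_mk, hp, coeff_mul]
      simp [hc]
  -- Iterating the equation `N` times leaves a remainder divisible by `X ^ N`. With `N = n + 1` it
  -- does not reach degree `n`, so no series has to be inverted.
  have key : ∀ N, PowerSeries.mk p = ∑ k ∈ range N, PowerSeries.C (w ^ k) * (c ^ (k + 1) * X ^ k) +
      PowerSeries.C (w ^ N) * (c ^ N * PowerSeries.mk p) * X ^ N := by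
    intro N
    induction N with
    | zero => simp
    | succ N ih =>
      rw [sum_range_succ]
      calc PowerSeries.mk p
          = ∑ k ∈ range N, PowerSeries.C (w ^ k) * (c ^ (k + 1) * X ^ k) +
            PowerSeries.C (w ^ N) * (c ^ N * (c + PowerSeries.C w * c * PowerSeries.mk p * X))
              * X ^ N := by rw [← hF]; exact ih
        _ = _ := by rw [map_pow, map_pow]; ring
  have h := congrArg (coeff n) (key (n + 1))
  rw [coeff_mk, map_add, coeff_mul_X_pow', if_neg (by omega), add_zero, map_sum] at h
  rw [h]
  refine sum_congr rfl fun k hk => ?_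
  rw [mem_range] at hk
  rw [coeff_C_mul, coeff_mul_X_pow', if_pos (by omega), hcoeff]

end FixedPointBiased

/-! ### Asymptotics of ballot sums and of the fixed point counts. -/

namespace FixedPointBiased
open Finset Filter Topology

/-- The number of ways to choose `n` among `2 * n - k`, relative to the central binomial. -/
noncomputable def chooseRatio (n k : ℕ) : ℝ :=
  if k ≤ n then ((2 * n - k).choose n : ℝ) / ((2 * n).choose n : ℝ) else 0

theorem chooseRatio_nonneg (n k : ℕ) : 0 ≤ chooseRatio n k := by
  unfold chooseRatio; split_ifs <;> positivity

theorem chooseRatio_zero (n : ℕ) : chooseRatio n 0 = 1 := by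
  have : ((2 * n).choose n : ℝ) ≠ 0 := by
    exact_mod_cast (Nat.choose_pos (by omega)).ne'
  simp [chooseRatio, this]

theorem chooseRatio_of_lt {n k : ℕ} (h : n < k) : chooseRatio n k = 0 := by
  rw [chooseRatio, if_neg (by omega)]

/-- The factor `(n - k) / (2n - k)` is at most `1 / 2` and tends to `1 / 2`, so this recursion
yields both the uniform bound and the limit. -/
theorem chooseRatio_succ {n k : ℕ} (h : k + 1 ≤ n) :
    chooseRatio n (k + 1) = chooseRatio n k * (((n : ℝ) - k) / (2 * n - k)) := by
  have h1 := Nat.choose_mul_succ_eq (2 * n - (k + 1)) n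
  rw [show 2 * n - (k + 1) + 1 = 2 * n - k by omega,
    show 2 * n - k - n = n - k by omega] at h1
  have h2 : ((2 * n - (k + 1)).choose n : ℝ) * (2 * n - k) =
      (2 * n - k).choose n * ((n : ℝ) - k) := by
    have := congrArg (Nat.cast : ℕ → ℝ) h1
    push_cast [Nat.cast_sub (show k ≤ n by omega), Nat.cast_sub (show k ≤ 2 * n by omega)] at this
    exact this
  have h3 : (2 * n - k : ℝ) ≠ 0 := by
    have : (k : ℝ) ≤ n := by exact_mod_cast (by omega : k ≤ n)
    have : (0 : ℝ) < n := by exact_mod_cast (by omega : 0 < n)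
    linarith
  rw [chooseRatio, chooseRatio, if_pos h, if_pos (by omega), div_mul_div_comm, ← h2, mul_div_mul_right _ _ h3]

theorem chooseRatio_le (n k : ℕ) : chooseRatio n k ≤ (1 / 2) ^ k := by
  induction k with
  | zero => simp [chooseRatio_zero]
  | succ k ih =>
    by_cases h : n < k + 1
    · rw [chooseRatio_of_lt h]; positivity
    · have hn : 0 < n := by omega
      rw [chooseRatio_succ (by omega), pow_succ]
      have hk : (k : ℝ) ≤ n := by exact_mod_cast (by omega : k ≤ n)
      have hn' : (0 : ℝ) < n := by exact_mod_cast hn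
      have hk0 : (0 : ℝ) ≤ k := by positivity
      refine mul_le_mul ih ?_ (div_nonneg (by linarith) (by linarith)) (by positivity)
      rw [div_le_div_iff₀ (by linarith) (by norm_num)]
      linarith

theorem tendsto_chooseRatio (k : ℕ) :
    Tendsto (fun n => chooseRatio n k) atTop (𝓝 ((1 / 2) ^ k)) := by
  induction k with
  | zero => simp [chooseRatio_zero]
  | succ k ih =>
    have h1 : Tendsto (fun n : ℕ => (k : ℝ) / n) atTop (𝓝 0) :=
      tendsto_const_div_atTop_nhds_zero_nat _
    have h2 : Tendsto (fun n : ℕ => (1 - (k : ℝ) / n) / (2 - k / n)) atTop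
        (𝓝 ((1 - 0) / (2 - 0))) :=
      (tendsto_const_nhds.sub h1).div (tendsto_const_nhds.sub h1) (by norm_num)
    rw [sub_zero, sub_zero] at h2
    rw [pow_succ]
    refine (ih.mul h2).congr' ?_
    filter_upwards [eventually_ge_atTop (k + 1)] with n hn
    have hn0 : (n : ℝ) ≠ 0 := by
      have : n ≠ 0 := by omega
      exact_mod_cast this
    rw [chooseRatio_succ hn, ← mul_div_mul_right (1 - (k : ℝ) / n) _ hn0]
    congr 2 <;> field_simp

theorem ballot_div_catalan {n k : ℕ} (h : k ≤ n) :
    (ballot (n - k) k : ℝ) / catalan n = (k + 1) * chooseRatio n k := by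
  have h1 := mul_ballot (n - k) k
  rw [show n - k + k + 1 = n + 1 by omega, show 2 * (n - k) + k = 2 * n - k by omega,
    Nat.choose_symm_of_eq_add (show 2 * n - k = (n - k) + n by omega)] at h1
  have h2 := mul_ballot n 0
  rw [ballot_zero_right] at h2
  simp only [add_zero, zero_add, one_mul] at h2
  have hc : ((2 * n).choose n : ℝ) ≠ 0 := by
    exact_mod_cast (Nat.choose_pos (by omega)).ne'
  have h1' : ((n : ℝ) + 1) * ballot (n - k) k = (k + 1) * (2 * n - k).choose n := by
    exact_mod_cast h1
  have h2' : ((n : ℝ) + 1) * catalan n = (2 * n).choose n := by exact_mod_cast h2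
  have hn : (n : ℝ) + 1 ≠ 0 := by positivity
  rw [chooseRatio, if_pos h, ← mul_div_mul_left _ _ hn, h1', h2', mul_div_assoc]

theorem catalan_pos (n : ℕ) : 0 < catalan n := by
  have h := succ_mul_catalan_eq_centralBinom n
  have := Nat.centralBinom_pos n
  by_contra h0
  simp only [not_lt, nonpos_iff_eq_zero] at h0
  simp [h0] at h
  omega

/-- Since `chooseRatio` is zero beyond `n`, the finite sum is a full series, and `chooseRatio_le`
supplies the domination. -/
theorem tendsto_sum_mul_ballot_div_catalan (w : ℕ → ℝ)
    (hw : Summable fun j : ℕ => |w j| * ((j + 1) * (1 / 2 : ℝ) ^ j)) :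
    Tendsto (fun n => (∑ j ∈ range (n + 1), w j * ballot (n - j) j) / catalan n) atTop
      (𝓝 (∑' j : ℕ, w j * ((j + 1) * (1 / 2 : ℝ) ^ j))) := by
  have h : ∀ n, (∑ j ∈ range (n + 1), w j * ballot (n - j) j) / (catalan n : ℝ) =
      ∑' j : ℕ, w j * ((j + 1) * chooseRatio n j) := by
    intro n
    rw [tsum_eq_sum (s := range (n + 1)), sum_div]
    · refine sum_congr rfl fun j hj => ?_
      rw [mem_range] at hj
      rw [mul_div_assoc, ballot_div_catalan (by omega)]
    · intro j hj
      rw [mem_range] at hj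
      rw [chooseRatio_of_lt (by omega)]
      simp
  simp only [h]
  refine tendsto_tsum_of_dominated_convergence hw
    (fun j => ((tendsto_chooseRatio j).const_mul _).const_mul _) (Eventually.of_forall ?_)
  intro n j
  rw [norm_mul, Real.norm_eq_abs, Real.norm_eq_abs,
    abs_of_nonneg (mul_nonneg (by positivity) (chooseRatio_nonneg n j))]
  have := chooseRatio_le n j
  gcongr

theorem hasSum_succ_mul_pow {y : ℝ} (hy : |y| < 1) :
    HasSum (fun j : ℕ => ((j : ℝ) + 1) * y ^ j) (1 / (1 - y) ^ 2) := by
  have h := hasSum_choose_mul_geometric_of_norm_lt_one 1 (r := y) (by simpa using hy)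
  simpa using h

theorem hasSum_choose_mul_succ_mul_pow (k : ℕ) {y : ℝ} (hy : |y| < 1) :
    HasSum (fun j : ℕ => (j.choose k : ℝ) * ((j + 1) * y ^ j))
      ((k + 1) * y ^ k / (1 - y) ^ (k + 2)) := by
  have h := (hasSum_choose_mul_geometric_of_norm_lt_one (k + 1) (r := y)
    (by simpa using hy)).mul_left ((k + 1) * y ^ k)
  rw [mul_one_div] at h
  -- The first `k` terms vanish; after the shift, `(n + k + 1) * choose (n + k) k` is absorbed into
  -- `choose (n + k + 1) (k + 1)`.
  refine (hasSum_nat_add_iff' k).1 ?_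
  have h0 : ∑ i ∈ range k, (i.choose k : ℝ) * ((i + 1) * y ^ i) = 0 :=
    sum_eq_zero fun i hi => by
      rw [Nat.choose_eq_zero_of_lt (mem_range.1 hi)]; simp
  rw [h0, sub_zero]
  refine h.congr_fun fun n => ?_
  have h1 := Nat.add_one_mul_choose_eq (n + k) k
  have h2 : ((n : ℝ) + k + 1) * (n + k).choose k = (n + (k + 1)).choose (k + 1) * (k + 1) := by
    exact_mod_cast h1
  push_cast
  rw [pow_add]
  linear_combination (y ^ n * y ^ k) * h2

/-- The expansion of a generating polynomial at `1` in terms of ballot numbers. -/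
def HasBallotExpansion {S : ℕ → Type} [∀ n, Fintype (S n)] (f : ∀ n, S n → ℕ) : Prop :=
  ∀ (R : Type) [CommRing R] (u : R) (n : ℕ),
    ∑ s : S n, u ^ f n s = ∑ k ∈ range (n + 1), (u - 1) ^ k * (ballot (n - k) k : R)

section Limit

variable {S : ℕ → Type} [∀ n, Fintype (S n)] {f : ∀ n, S n → ℕ}

theorem HasBallotExpansion.tendsto_sum_pow (hf : HasBallotExpansion f) {q : ℝ} (hq0 : 0 < q)
    (hq3 : q < 3) :
    Tendsto (fun n => (∑ s : S n, q ^ f n s) / catalan n) atTop (𝓝 (4 / (3 - q) ^ 2)) := by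
  -- The bound `q < 3` is exactly what the geometric ratio needs here.
  have hy : |(q - 1) / 2| < 1 := by rw [abs_lt]; constructor <;> linarith
  have h := tendsto_sum_mul_ballot_div_catalan (fun j => (q - 1) ^ j) (by
    refine ((hasSum_succ_mul_pow (y := |(q - 1) / 2|) (by simpa using hy)).summable).congr
      fun j => ?_
    rw [abs_pow, abs_div, abs_two, div_pow, one_div, inv_pow]
    ring)
  simp only [hf ℝ q]
  convert h using 2
  refine (((hasSum_succ_mul_pow hy).congr_fun fun j => ?_).tsum_eq.trans ?_).symm
  · simp only [div_pow, one_pow]; ring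
  · rw [show 1 - (q - 1) / 2 = (3 - q) / 2 by ring, div_pow, one_div_div]
    norm_num

/-- Coefficient extraction from the expansion over `Polynomial ℝ` with `u = X`. The truncated
exponent `j - k` is harmless, as `j.choose k` vanishes for `j < k`. -/
theorem HasBallotExpansion.card_eq (hf : HasBallotExpansion f) (k n : ℕ) :
    ((univ.filter fun s : S n => f n s = k).card : ℝ) =
      ∑ j ∈ range (n + 1), ((-1) ^ (j - k) * (j.choose k : ℝ)) * ballot (n - j) j := by
  have h := congrArg (fun P => Polynomial.coeff P k) (hf (Polynomial ℝ) Polynomial.X n)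
  simp only [Polynomial.finsetSum_coeff, Polynomial.coeff_X_pow] at h
  rw [card_filter]
  push_cast
  simp only [eq_comm (b := k)]
  rw [h]
  refine sum_congr rfl fun j _ => ?_
  rw [← Polynomial.C_eq_natCast, Polynomial.coeff_mul_C, sub_eq_add_neg, ← Polynomial.C_1,
    ← Polynomial.C_neg, Polynomial.coeff_X_add_C_pow]

theorem HasBallotExpansion.tendsto_card (hf : HasBallotExpansion f) (k : ℕ) :
    Tendsto (fun n => ((univ.filter fun s : S n => f n s = k).card : ℝ) / catalan n) atTop
      (𝓝 (4 / 9 * (k + 1) * (1 / 3) ^ k)) := by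
  -- The value `y = 1 / 2` gives the dominating series; `y = -1 / 2` evaluates the limit.
  have hp := hasSum_choose_mul_succ_mul_pow k (y := 1 / 2) (by rw [abs_lt]; norm_num)
  have hm := hasSum_choose_mul_succ_mul_pow k (y := -1 / 2) (by rw [abs_lt]; norm_num)
  have h := tendsto_sum_mul_ballot_div_catalan (fun j => (-1) ^ (j - k) * (j.choose k : ℝ)) (by
    refine hp.summable.congr fun j => ?_
    rw [abs_mul, abs_pow, abs_neg, abs_one, one_pow, one_mul, Nat.abs_cast])
  simp only [hf.card_eq k]
  convert h using 2
  refine (((hm.mul_left ((-1) ^ k)).congr_fun fun j => ?_).tsum_eq.trans ?_).symm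
  · rcases lt_or_ge j k with hj | hj
    · rw [Nat.choose_eq_zero_of_lt hj]; simp
    · obtain ⟨i, rfl⟩ := Nat.exists_eq_add_of_le hj
      have h1 : (-1 : ℝ) ^ k * (-1) ^ k = 1 := by rw [← mul_pow]; norm_num
      rw [show k + i - k = i by omega, neg_div, neg_pow (1 / 2 : ℝ), pow_add (-1 : ℝ)]
      push_cast
      linear_combination (-(-1) ^ i * ((k + i).choose k : ℝ) * ((k + i + 1) * (1 / 2) ^ (k + i))) * h1
  · have h1 : (-1 : ℝ) ^ k * (-1) ^ k = 1 := by rw [← mul_pow]; norm_num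
    rw [show (1 - -1 / 2 : ℝ) = 3 / 2 by norm_num, neg_div, neg_pow (1 / 2 : ℝ), div_pow, div_pow,
      div_pow, pow_add (3 : ℝ), pow_add (2 : ℝ)]
    field_simp
    linear_combination (36 : ℝ) * h1

theorem HasBallotExpansion.tendsto_weight (hf : HasBallotExpansion f) {q : ℝ} (hq0 : 0 < q)
    (hq3 : q < 3) (k : ℕ) :
    Tendsto (fun n => ((univ.filter fun s : S n => f n s = k).card : ℝ) * q ^ k /
        ∑ s : S n, q ^ f n s) atTop
      (𝓝 (((k + 2 - 1).choose k : ℝ) * (1 - (1 - q / 3)) ^ k * (1 - q / 3) ^ 2)) := by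
  have h3 : 3 - q ≠ 0 := by linarith
  have h := ((hf.tendsto_card k).mul_const (q ^ k)).div (hf.tendsto_sum_pow hq0 hq3)
    (by positivity)
  convert h using 2 with n
  · have : (catalan n : ℝ) ≠ 0 := by exact_mod_cast (catalan_pos n).ne'
    rw [Pi.div_apply, div_mul_eq_mul_div, div_div_div_cancel_right₀ this]
  · rw [show k + 2 - 1 = k + 1 by omega, Nat.choose_succ_self_right, sub_sub_cancel, div_pow, div_pow 1,
      one_pow, show 1 - q / 3 = (3 - q) / 3 by ring]
    push_cast
    field_simp
    ring

end Limit
end FixedPointBiased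

/-! ### From convergence of point masses to convergence in distribution. -/

namespace FixedPointBiased
open Finset Filter Topology MeasureTheory

/-- Fatou's lemma for the counting measure. -/
theorem tsum_liminf_le_liminf_tsum (a : ℕ → ℕ → ENNReal) :
    ∑' k, liminf (fun n => a n k) atTop ≤ liminf (fun n => ∑' k, a n k) atTop := by
  have h := lintegral_liminf_le (u := atTop) (μ := Measure.count) (f := a)
    (fun n => measurable_of_countable (a n))
  simpa only [lintegral_count] using h

/-- Splitting the mass of `f ⁻¹' A` over the fibres of `f` reduces this to Fatou, so no tightness
argument is needed. -/
theorem le_liminf_sum_of_tendsto {S : ℕ → Type*} [∀ n, Fintype (S n)] (f : ∀ n, S n → ℕ)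
    (m : ∀ n, S n → ENNReal) (p : ℕ → ENNReal)
    (h : ∀ k, Tendsto (fun n => ∑ s : S n, if f n s = k then m n s else 0) atTop (𝓝 (p k)))
    (A : Set ℕ) :
    ∑' k, A.indicator p k ≤ liminf (fun n => ∑ s : S n, (f n ⁻¹' A).indicator (m n) s) atTop := by
  classical
  have h1 : ∀ n, ∑ s : S n, (f n ⁻¹' A).indicator (m n) s =
      ∑' k, A.indicator (fun k => ∑ s : S n, if f n s = k then m n s else 0) k := by
    intro n
    have : ∀ k, A.indicator (fun k => ∑ s : S n, if f n s = k then m n s else 0) k =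
        ∑ s : S n, if k = f n s then (f n ⁻¹' A).indicator (m n) s else 0 := by
      intro k
      by_cases hk : k ∈ A
      · rw [Set.indicator_of_mem hk]
        refine sum_congr rfl fun s _ => ?_
        by_cases hs : k = f n s
        · subst hs
          rw [if_pos rfl, if_pos rfl, Set.indicator_of_mem (by exact hk)]
        · rw [if_neg hs, if_neg (Ne.symm hs)]
      · rw [Set.indicator_of_notMem hk]
        refine (sum_eq_zero fun s _ => ?_).symm
        by_cases hs : k = f n s
        · subst hs
          rw [if_pos rfl, Set.indicator_of_notMem (by exact hk)]
        · rw [if_neg hs]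
    simp only [this]
    rw [Summable.tsum_finsetSum fun _ _ => ENNReal.summable]
    simp
  simp only [h1]
  refine le_trans (ENNReal.tsum_le_tsum fun k => ?_) (tsum_liminf_le_liminf_tsum _)
  by_cases hk : k ∈ A
  · simp only [Set.indicator_of_mem hk]
    exact (h k).liminf_eq.ge
  · simp [Set.indicator_of_notMem hk]

instance discreteMeasurableSpace_avoidingPerm (n : ℕ) {m : ℕ} (τ : Equiv.Perm (Fin m)) :
    DiscreteMeasurableSpace (AvoidingPerm n τ) := ⟨fun _ => trivial⟩

theorem tendstoInDistribution_of_hasBallotExpansion {m : ℕ} (hm : 2 ≤ m)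
    (τ : Equiv.Perm (Fin m))
    (hτ : HasBallotExpansion fun n (σ : AvoidingPerm n τ) => fp σ.1)
    (q : ℝ) (hq0 : 0 < q) (hq3 : q < 3) :
    TendstoInDistribution (fun (n : ℕ) (σ : AvoidingPerm n τ) => (fp σ.1 : ℝ)) atTop
      (fun k : ℕ => (k : ℝ)) (fun n : ℕ => (biasedPMF n q hq0 hm τ).toMeasure)
      (negativeBinomialPMF 2 (by norm_num) (1 - q / 3)
        (by linarith) (by linarith)).toMeasure := by
  have hmeas : ∀ n, Measurable fun σ : AvoidingPerm n τ => (fp σ.1 : ℝ) :=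
    fun n => measurable_from_top
  have hcast : Measurable fun k : ℕ => (k : ℝ) := measurable_from_top
  refine ⟨fun n => (hmeas n).aemeasurable, hcast.aemeasurable, ?_⟩
  -- Portmanteau: for probability measures a lower bound on open sets suffices.
  refine tendsto_of_forall_isOpen_le_liminf' fun G hG => ?_
  simp only [ProbabilityMeasure.coe_mk]
  rw [Measure.map_apply hcast hG.measurableSet]
  have hn : ∀ n, ((biasedPMF n q hq0 hm τ).toMeasure.map fun σ => (fp σ.1 : ℝ)) G =
      ∑ σ : AvoidingPerm n τ, ((fun σ : AvoidingPerm n τ => fp σ.1) ⁻¹'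
        ((fun k : ℕ => (k : ℝ)) ⁻¹' G)).indicator (biasedPMF n q hq0 hm τ) σ := by
    intro n
    rw [Measure.map_apply (hmeas n) hG.measurableSet]
    exact PMF.toMeasure_apply_fintype _ _
  simp only [hn]
  rw [PMF.toMeasure_apply _ (hcast hG.measurableSet)]
  refine le_liminf_sum_of_tendsto (fun n (σ : AvoidingPerm n τ) => fp σ.1) _ _ (fun k => ?_) _
  refine (ENNReal.tendsto_ofReal (hτ.tendsto_weight hq0 hq3 k)).congr fun n => ?_
  have hZ : 0 < normalization n q τ := normalization_pos n hq0 hm τ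
  rw [← sum_filter]
  have : ∀ σ ∈ univ.filter fun σ : AvoidingPerm n τ => fp σ.1 = k,
      biasedPMF n q hq0 hm τ σ = ENNReal.ofReal (q ^ k / normalization n q τ) := by
    intro σ hσ
    rw [← (mem_filter.1 hσ).2]
    rfl
  rw [sum_congr rfl this, sum_const, nsmul_eq_mul, mul_div_assoc,
    ENNReal.ofReal_mul (Nat.cast_nonneg _), ENNReal.ofReal_natCast]
  rfl

end FixedPointBiased

/-! ### Patterns, the reverse complement symmetry, and gluing of blocks. -/

namespace FixedPointBiased
open Finset

section Patterns

variable {n : ℕ}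

/-- `σ` has no occurrence of the pattern `132`. -/
def Avoids132 (σ : Equiv.Perm (Fin n)) : Prop :=
  ∀ i j k, i < j → j < k → σ i < σ k → ¬ σ k < σ j

/-- `σ` has no occurrence of the pattern `321`. -/
def Avoids321 (σ : Equiv.Perm (Fin n)) : Prop :=
  ∀ i j k, i < j → j < k → σ k < σ j → ¬ σ j < σ i

theorem strictMono_vec3 {i j k : Fin n} (hij : i < j) (hjk : j < k) :
    StrictMono ![i, j, k] := by
  rw [Fin.strictMono_iff_lt_succ]
  intro a
  fin_cases a
  · exact hij
  · exact hjk

theorem not_containsPattern132_iff (σ : Equiv.Perm (Fin n)) :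
    ¬ ContainsPattern σ pattern132 ↔ Avoids132 σ := by
  constructor
  · intro h i j k hij hjk h1 h2
    refine h ⟨![i, j, k], strictMono_vec3 hij hjk, fun a b => ?_⟩
    have h3 := h1.trans h2
    fin_cases a <;> fin_cases b <;>
      simp [pattern132, h1, h2, h3, h1.le, h2.le, h3.le]
  · rintro h ⟨i, hi, hc⟩
    refine h (i 0) (i 1) (i 2) (hi (by decide)) (hi (by decide)) ((hc 0 2).2 ?_) ((hc 2 1).2 ?_)
      <;> decide

theorem not_containsPattern321_iff (σ : Equiv.Perm (Fin n)) :
    ¬ ContainsPattern σ pattern321 ↔ Avoids321 σ := by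
  constructor
  · intro h i j k hij hjk h1 h2
    refine h ⟨![i, j, k], strictMono_vec3 hij hjk, fun a b => ?_⟩
    have h3 := h1.trans h2
    fin_cases a <;> fin_cases b <;>
      simp [pattern321, h1, h2, h3, h1.le, h2.le, h3.le]
  · rintro h ⟨i, hi, hc⟩
    refine h (i 0) (i 1) (i 2) (hi (by decide)) (hi (by decide)) ((hc 2 1).2 ?_) ((hc 1 0).2 ?_)
      <;> decide

/-- Conjugation by the order reversal, i.e. the reverse complement. -/
def reverseComplement (n : ℕ) : Equiv.Perm (Fin n) ≃ Equiv.Perm (Fin n) :=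
  Equiv.permCongr Fin.revPerm

@[simp] theorem reverseComplement_apply (σ : Equiv.Perm (Fin n)) (i : Fin n) :
    reverseComplement n σ i = (σ i.rev).rev := by
  simp [reverseComplement]

theorem reverseComplement_reverseComplement (σ : Equiv.Perm (Fin n)) :
    reverseComplement n (reverseComplement n σ) = σ := by
  ext i; simp

theorem ContainsPattern.reverseComplement {m : ℕ} {σ : Equiv.Perm (Fin n)}
    {τ : Equiv.Perm (Fin m)} (h : ContainsPattern σ τ) :
    ContainsPattern (reverseComplement n σ) (reverseComplement m τ) := by
  obtain ⟨i, hi, hc⟩ := h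
  refine ⟨fun a => (i a.rev).rev, fun a b hab => ?_, fun a b => ?_⟩
  · simpa using hi (by simpa using hab)
  · simp [hc]

theorem containsPattern_reverseComplement_iff {m : ℕ} {σ : Equiv.Perm (Fin n)}
    {τ : Equiv.Perm (Fin m)} :
    ContainsPattern (reverseComplement n σ) (reverseComplement m τ) ↔ ContainsPattern σ τ := by
  refine ⟨fun h => ?_, fun h => h.reverseComplement⟩
  simpa only [reverseComplement_reverseComplement] using h.reverseComplement

theorem reverseComplement_pattern132 : reverseComplement 3 pattern132 = pattern213 := by
  ext i; fin_cases i <;> rfl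

theorem fp_reverseComplement (σ : Equiv.Perm (Fin n)) :
    fp (reverseComplement n σ) = fp σ := by
  unfold fp
  refine card_bij' (fun i _ => i.rev) (fun i _ => i.rev) ?_ ?_ ?_ ?_
  · intro i hi
    simp only [mem_filter, mem_univ, true_and, reverseComplement_apply] at hi ⊢
    have := congrArg Fin.rev hi
    rwa [Fin.rev_rev] at this
  · intro i hi
    simp only [mem_filter, mem_univ, true_and, reverseComplement_apply, Fin.rev_rev] at hi ⊢
    rw [hi]
  · simp
  · simp

end Patterns

section Blocks

/-- The positions before position `l`. -/
def leftIdx (l r : ℕ) (i : Fin l) : Fin (l + r + 1) := ⟨i, by omega⟩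

/-- The position `l`. -/
def midIdx (l r : ℕ) : Fin (l + r + 1) := ⟨l, by omega⟩

/-- The positions after position `l`. -/
def rightIdx (l r : ℕ) (j : Fin r) : Fin (l + r + 1) := ⟨l + 1 + j, by omega⟩

@[simp] theorem val_leftIdx (l r : ℕ) (i : Fin l) : (leftIdx l r i : ℕ) = i := rfl
@[simp] theorem val_midIdx (l r : ℕ) : (midIdx l r : ℕ) = l := rfl
@[simp] theorem val_rightIdx (l r : ℕ) (j : Fin r) : (rightIdx l r j : ℕ) = l + 1 + j := rfl

variable {l r : ℕ}

theorem idx_cases {motive : Fin (l + r + 1) → Prop} (left : ∀ i, motive (leftIdx l r i))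
    (mid : motive (midIdx l r)) (right : ∀ j, motive (rightIdx l r j)) (x : Fin (l + r + 1)) :
    motive x := by
  rcases lt_trichotomy (x : ℕ) l with h | h | h
  · exact left ⟨x, h⟩
  · convert mid using 1
    exact Fin.ext h
  · convert right ⟨x - (l + 1), by omega⟩ using 1
    ext
    simp
    omega

theorem sum_idx {M : Type*} [AddCommMonoid M] (g : Fin (l + r + 1) → M) :
    ∑ x, g x = ∑ i, g (leftIdx l r i) + (g (midIdx l r) + ∑ j, g (rightIdx l r j)) := by
  have h := Fin.sum_univ_add (a := l) (b := r + 1) g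
  rw [Fin.sum_univ_succ] at h
  refine h.trans ?_
  congr 2
  refine sum_congr rfl fun j _ => congrArg g ?_
  ext
  simp [Fin.natAdd]
  omega

/-- The values `{a, …, a + l - 1}`, `{c}` and `{b, …, b + r - 1}` are disjoint and contained in
`{0, …, l + r}`. -/
structure BlockLayout (l r a c b : ℕ) : Prop where
  left_le : a + l ≤ l + r + 1
  mid_lt : c < l + r + 1
  right_le : b + r ≤ l + r + 1
  mid_left : c < a ∨ a + l ≤ c
  mid_right : c < b ∨ b + r ≤ c
  left_right : a + l ≤ b ∨ b + r ≤ a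

variable {a c b : ℕ}

/-- The values of the permutation glued from `α` and `β`. -/
def glueFun (H : BlockLayout l r a c b) (α : Equiv.Perm (Fin l)) (β : Equiv.Perm (Fin r))
    (x : Fin (l + r + 1)) : Fin (l + r + 1) :=
  if h : (x : ℕ) < l then ⟨α ⟨x, h⟩ + a, by have := H.left_le; omega⟩
  else if h' : (x : ℕ) = l then ⟨c, H.mid_lt⟩
  else ⟨β ⟨x - (l + 1), by omega⟩ + b, by have := H.right_le; omega⟩

variable (H : BlockLayout l r a c b) (α : Equiv.Perm (Fin l)) (β : Equiv.Perm (Fin r))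

theorem glueFun_left (i : Fin l) : (glueFun H α β (leftIdx l r i) : ℕ) = α i + a := by
  simp [glueFun]

theorem glueFun_mid : (glueFun H α β (midIdx l r) : ℕ) = c := by
  simp [glueFun]

theorem glueFun_right (j : Fin r) : (glueFun H α β (rightIdx l r j) : ℕ) = β j + b := by
  rw [glueFun, dif_neg (by simp; omega), dif_neg (by simp; omega)]
  simp

theorem glueFun_injective : Function.Injective (glueFun H α β) := by
  intro x y hxy
  have hxy := congrArg Fin.val hxy
  have h1 := H.mid_left
  have h2 := H.mid_right
  have h3 := H.left_right
  induction x using idx_cases with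
  | left i =>
    induction y using idx_cases with
    | left j =>
      rw [glueFun_left, glueFun_left] at hxy
      rw [α.injective (Fin.ext (by omega) : α i = α j)]
    | mid => rw [glueFun_left, glueFun_mid] at hxy; omega
    | right j => rw [glueFun_left, glueFun_right] at hxy; omega
  | mid =>
    induction y using idx_cases with
    | left j => rw [glueFun_left, glueFun_mid] at hxy; omega
    | mid => rfl
    | right j => rw [glueFun_mid, glueFun_right] at hxy; omega
  | right i =>
    induction y using idx_cases with
    | left j => rw [glueFun_left, glueFun_right] at hxy; omega
    | mid => rw [glueFun_mid, glueFun_right] at hxy; omega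
    | right j =>
      rw [glueFun_right, glueFun_right] at hxy
      rw [β.injective (Fin.ext (by omega) : β i = β j)]

/-- The permutation of `Fin (l + r + 1)` that is order-isomorphic to `α` on the positions before
`l`, with values in `{a, …, a + l - 1}`, has the value `c` at `l`, and is order-isomorphic to `β`
on the positions after `l`, with values in `{b, …, b + r - 1}`. -/
noncomputable def glue : Equiv.Perm (Fin (l + r + 1)) :=
  Equiv.ofBijective (glueFun H α β) (Finite.injective_iff_bijective.1 (glueFun_injective H α β))

@[simp] theorem glue_left (i : Fin l) : (glue H α β (leftIdx l r i) : ℕ) = α i + a :=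
  glueFun_left H α β i

@[simp] theorem glue_mid : (glue H α β (midIdx l r) : ℕ) = c := glueFun_mid H α β

@[simp] theorem glue_right (j : Fin r) : (glue H α β (rightIdx l r j) : ℕ) = β j + b :=
  glueFun_right H α β j

/-- `σ` maps the three blocks of positions to the three blocks of values. -/
structure RespectsBlocks (a c b : ℕ) (σ : Equiv.Perm (Fin (l + r + 1))) : Prop where
  left : ∀ i, a ≤ (σ (leftIdx l r i) : ℕ) ∧ (σ (leftIdx l r i) : ℕ) < a + l
  mid : (σ (midIdx l r) : ℕ) = c
  right : ∀ j, b ≤ (σ (rightIdx l r j) : ℕ) ∧ (σ (rightIdx l r j) : ℕ) < b + r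

theorem respectsBlocks_glue : RespectsBlocks a c b (glue H α β) where
  left i := by simp; omega
  mid := by simp
  right j := by simp; omega

theorem glue_injective {α α' : Equiv.Perm (Fin l)} {β β' : Equiv.Perm (Fin r)}
    (h : glue H α β = glue H α' β') : α = α' ∧ β = β' := by
  constructor
  · ext i
    have := congrArg (fun σ => (σ (leftIdx l r i) : ℕ)) h
    simpa using this
  · ext j
    have := congrArg (fun σ => (σ (rightIdx l r j) : ℕ)) h
    simpa using this

theorem leftIdx_injective : Function.Injective (leftIdx l r) := by
  intro i j h
  have := congrArg Fin.val h
  exact Fin.ext this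

theorem rightIdx_injective : Function.Injective (rightIdx l r) := by
  intro i j h
  have := congrArg Fin.val h
  simp at this
  exact Fin.ext this

theorem RespectsBlocks.exists_glue {σ : Equiv.Perm (Fin (l + r + 1))}
    (hσ : RespectsBlocks a c b σ) : ∃ α β, glue H α β = σ := by
  let α : Fin l → Fin l := fun i => ⟨σ (leftIdx l r i) - a, by have := hσ.left i; omega⟩
  let β : Fin r → Fin r := fun j => ⟨σ (rightIdx l r j) - b, by have := hσ.right j; omega⟩
  have hα : Function.Injective α := by
    intro i j h
    have h := congrArg Fin.val h
    have h1 := hσ.left i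
    have h2 := hσ.left j
    simp only [α] at h
    exact leftIdx_injective (σ.injective (Fin.ext (by omega)))
  have hβ : Function.Injective β := by
    intro i j h
    have h := congrArg Fin.val h
    have h1 := hσ.right i
    have h2 := hσ.right j
    simp only [β] at h
    exact rightIdx_injective (σ.injective (Fin.ext (by omega)))
  refine ⟨Equiv.ofBijective α (Finite.injective_iff_bijective.1 hα),
    Equiv.ofBijective β (Finite.injective_iff_bijective.1 hβ), ?_⟩
  ext x
  induction x using idx_cases with
  | left i =>
    have := hσ.left i
    simp [α]
    omega
  | mid => simp [hσ.mid]
  | right j =>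
    have := hσ.right j
    simp [β]
    omega

-- Gluing is a bijection from pairs `(α, β)` onto the block-respecting permutations; this factorizes
-- the generating polynomials below.
open Classical in
theorem sum_respectsBlocks {M : Type*} [AddCommMonoid M]
    (W : Equiv.Perm (Fin (l + r + 1)) → M) :
    ∑ σ with RespectsBlocks a c b σ, W σ = ∑ α, ∑ β, W (glue H α β) := by
  rw [← Fintype.sum_prod_type']
  symm
  refine sum_bij (fun x _ => glue H x.1 x.2) ?_ ?_ ?_ ?_
  · intro x _
    simpa using respectsBlocks_glue H x.1 x.2
  · intro x _ y _ h
    obtain ⟨h1, h2⟩ := glue_injective H h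
    exact Prod.ext h1 h2
  · intro σ hσ
    obtain ⟨α, β, h⟩ := (mem_filter.1 hσ).2.exists_glue H
    exact ⟨(α, β), mem_univ _, h⟩
  · intro x _; rfl

end Blocks
end FixedPointBiased

/-! ### Entries on diagonals of `132`-avoiders, and the pattern `213`. -/

namespace FixedPointBiased
open Finset

section Recurrence

variable {R : Type*} [CommRing R]

/-- The convolution of the Catalan numbers, starting at index `|h|`, with the sequence `p`. -/
def catalanTail (p : ℕ → R) (n : ℕ) (h : ℤ) : R :=
  ∑ m ∈ range n, if |h| ≤ m then (catalan m : R) * p (n - 1 - m) else 0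

theorem catalanTail_of_le (p : ℕ → R) {n : ℕ} {h : ℤ} (hn : (n : ℤ) ≤ |h|) :
    catalanTail p n h = 0 :=
  sum_eq_zero fun m hm => if_neg (by rw [mem_range] at hm; omega)

theorem sum_antidiagonal_catalan_mul (n : ℕ) :
    ∑ x ∈ antidiagonal n, (catalan x.1 : R) * catalan x.2 = catalan (n + 1) := by
  rw [catalan_succ']
  push_cast
  rfl

/-- Regroups the double sum by the total size `s` of the two Catalan factors. -/
theorem sum_antidiagonal_mul_catalanTail (p : ℕ → R) (n : ℕ) (g : ℤ → ℤ) :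
    ∑ x ∈ antidiagonal n, (catalan x.1 : R) * catalanTail p x.2 (g x.1) =
      ∑ s ∈ range n, ∑ x ∈ antidiagonal s,
        if |g x.1| ≤ x.2 then (catalan x.1 : R) * catalan x.2 * p (n - 1 - s) else 0 := by
  rw [Nat.sum_antidiagonal_eq_sum_range_succ
    (fun i j => (catalan i : R) * catalanTail p j (g i)), sum_range_succ]
  simp only [catalanTail, Nat.sub_self, range_zero, sum_empty, mul_zero, add_zero]
  have h := sum_range_diag_flip n fun x y : ℕ =>
    if |g x| ≤ y then (catalan x : R) * catalan y * p (n - 1 - (x + y)) else 0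
  trans
  · exact Eq.trans (by
      refine sum_congr rfl fun x _ => ?_
      rw [mul_sum]
      refine sum_congr rfl fun y _ => ?_
      rw [mul_ite, mul_zero, ← mul_assoc, show n - x - 1 - y = n - 1 - (x + y) by omega]) h.symm
  · refine sum_congr rfl fun s _ => ?_
    rw [Nat.sum_antidiagonal_eq_sum_range_succ (fun x y =>
      if |g x| ≤ y then (catalan x : R) * catalan y * p (n - 1 - s) else 0)]
    refine sum_congr rfl fun x hx => ?_
    rw [mem_range] at hx
    rw [show x + (s - x) = s by omega]

/-- For Catalan factors of total size `s`, the conditions from the two tail sums, once one is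
reflected, are disjoint and together say `-s ≤ h ≤ s + 1`. The Catalan convolution then gives
`catalan (s + 1)`. The missing case `h = -(s + 1)` of `|h| ≤ s + 1`, and the term of index `0`, come
from the indicator. -/
theorem catalanTail_succ (p : ℕ → R) (n : ℕ) (h : ℤ) :
    ∑ x ∈ antidiagonal n, ((if h = -x.2 then (catalan x.2 : R) * p x.1 else 0) +
      (catalan x.2 : R) * catalanTail p x.1 (h + x.2) +
      (catalan x.1 : R) * catalanTail p x.2 (h - x.1 - 1)) = catalanTail p (n + 1) h := by
  rw [sum_add_distrib, sum_add_distrib,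
    ← Nat.sum_antidiagonal_swap (f := fun x => if h = -x.2 then (catalan x.2 : R) * p x.1 else 0),
    ← Nat.sum_antidiagonal_swap
      (f := fun x => (catalan x.2 : R) * catalanTail p x.1 (h + x.2)),
    sum_antidiagonal_mul_catalanTail p n (fun x => h - x - 1)]
  simp only [Prod.fst_swap, Prod.snd_swap]
  rw [sum_antidiagonal_mul_catalanTail p n (fun x => h + x), add_assoc, ← sum_add_distrib,
    Nat.sum_antidiagonal_eq_sum_range_succ
      (fun i j => if h = -(i : ℤ) then (catalan i : R) * p j else 0),
    catalanTail, sum_range_succ', sum_range_succ' _ n, add_right_comm, ← sum_add_distrib]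
  congr 1
  · refine sum_congr rfl fun s _ => ?_
    rw [← Nat.sum_antidiagonal_swap (f := fun x =>
      if |h - x.1 - 1| ≤ x.2 then (catalan x.1 : R) * catalan x.2 * p (n - 1 - s) else 0),
      ← sum_add_distrib]
    have h1 : ∀ x ∈ antidiagonal s,
        ((if |h + x.1| ≤ x.2 then (catalan x.1 : R) * catalan x.2 * p (n - 1 - s) else 0) +
          if |h - x.swap.1 - 1| ≤ x.swap.2 then
            (catalan x.swap.1 : R) * catalan x.swap.2 * p (n - 1 - s) else 0) =
        (catalan x.1 : R) * catalan x.2 *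
          (if -(s : ℤ) ≤ h ∧ h ≤ s + 1 then p (n - 1 - s) else 0) := by
      rintro ⟨x, y⟩ hx
      rw [HasAntidiagonal.mem_antidiagonal] at hx
      simp only [Prod.fst_swap, Prod.snd_swap, abs_le] at hx ⊢
      by_cases h1 : -(y : ℤ) ≤ h + x ∧ h + x ≤ y
      · rw [if_pos h1, if_neg (by omega), if_pos (by omega), add_zero]
      · by_cases h2 : -(x : ℤ) ≤ h - y - 1 ∧ h - y - 1 ≤ x
        · rw [if_neg h1, if_pos h2, if_pos (by omega)]; ring
        · rw [if_neg h1, if_neg h2, if_neg (by omega)]; ring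
    rw [sum_congr rfl h1, ← sum_mul, sum_antidiagonal_catalan_mul,
      show n + 1 - 1 - (s + 1) = n - 1 - s by omega, show n - (s + 1) = n - 1 - s by omega]
    simp only [abs_le]
    push_cast
    by_cases h2 : h = -((s : ℤ) + 1)
    · rw [if_pos h2, if_neg (by omega), if_pos (by omega)]; ring
    · by_cases h3 : -(s : ℤ) ≤ h ∧ h ≤ s + 1
      · rw [if_neg h2, if_pos h3, if_pos (by omega)]; ring
      · rw [if_neg h2, if_neg h3, if_neg (by omega)]; ring
  · simp [abs_nonpos_iff]

/-- The solution of the recurrence satisfied by the generating polynomials of `132`-avoiding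
permutations by the number of entries on a given diagonal. -/
theorem eq_catalan_add_catalanTail (u : R) (P : ℕ → ℤ → R) (h0 : ∀ h, P 0 h = 1)
    (hP : ∀ n h, P (n + 1) h = ∑ x ∈ antidiagonal n,
      (if h = -x.2 then u else 1) * P x.1 (h + x.2) * P x.2 (h - x.1 - 1)) (n : ℕ) (h : ℤ) :
    P n h = catalan n + (u - 1) * catalanTail (fun j => P j 0) n h := by
  induction n using Nat.strong_induction_on generalizing h with
  | _ n ih =>
    cases n with
    | zero => simp [h0, catalanTail]
    | succ n =>
      rw [hP, ← catalanTail_succ, ← sum_antidiagonal_catalan_mul, mul_sum, ← sum_add_distrib]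
      refine sum_congr rfl fun x hx => ?_
      obtain ⟨l, r⟩ := x
      rw [HasAntidiagonal.mem_antidiagonal] at hx
      simp only at hx ⊢
      rw [ih r (by omega) (h - l - 1)]
      by_cases hr : h = -r
      -- Here the maximum lies on the diagonal, which then misses the right block and is the main
      -- diagonal of the left one.
      · rw [if_pos hr, if_pos hr, catalanTail_of_le _ (n := r) (by rw [le_abs]; omega),
          show h + r = 0 by omega]
        linear_combination (catalan r : R) * ih l (by omega) 0
      · rw [if_neg hr, if_neg hr, ih l (by omega) (h + r)]
        -- A diagonal cannot meet both blocks: `|h + r| < l` forces `h - l - 1 < -r`. Hence the term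
        -- in `(u - 1) ^ 2` drops out.
        have : catalanTail (fun j => P j 0) l (h + r) *
            catalanTail (fun j => P j 0) r (h - l - 1) = 0 := by
          rcases le_or_gt (l : ℤ) |h + r| with h1 | h1
          · rw [catalanTail_of_le _ h1, zero_mul]
          · rw [abs_lt] at h1
            rw [catalanTail_of_le _ (n := r) (by rw [le_abs]; omega), mul_zero]
        linear_combination (u - 1) ^ 2 * this

end Recurrence

section Decomposition

variable {l r : ℕ}

theorem blockLayout132 (l r : ℕ) : BlockLayout l r r (l + r) 0 := by
  constructor <;> omega

/-- All left values exceed all right ones and the maximum sits between, so an occurrence of `132`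
stays within one block. -/
theorem avoids132_glue (α : Equiv.Perm (Fin l)) (β : Equiv.Perm (Fin r)) :
    Avoids132 (glue (blockLayout132 l r) α β) ↔ Avoids132 α ∧ Avoids132 β := by
  constructor
  · intro h
    constructor
    · intro i j k
      have := h (leftIdx l r i) (leftIdx l r j) (leftIdx l r k)
      simp only [Fin.lt_def, val_leftIdx, glue_left] at this ⊢
      omega
    · intro i j k
      have := h (rightIdx l r i) (rightIdx l r j) (rightIdx l r k)
      simp only [Fin.lt_def, val_rightIdx, glue_right] at this ⊢
      omega
  · rintro ⟨hα, hβ⟩ i j k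
    induction i using idx_cases <;> induction j using idx_cases <;>
      induction k using idx_cases <;>
      simp only [Fin.lt_def, val_leftIdx, val_midIdx, val_rightIdx, glue_left, glue_mid,
        glue_right] <;> try omega
    · rename_i i j k
      have := hα i j k
      simp only [Fin.lt_def] at this
      omega
    · rename_i i j k
      have := hβ i j k
      simp only [Fin.lt_def] at this
      omega

theorem Avoids132.respectsBlocks {σ : Equiv.Perm (Fin (l + r + 1))} (h : Avoids132 σ)
    (hσ : (σ (midIdx l r) : ℕ) = l + r) : RespectsBlocks r (l + r) 0 σ := by
  have hlt : ∀ x, x ≠ midIdx l r → (σ x : ℕ) < l + r := by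
    intro x hx
    have h1 : (σ x : ℕ) ≠ l + r := fun h2 => hx (σ.injective (Fin.ext (h2.trans hσ.symm)))
    omega
  have hl : ∀ i, leftIdx l r i ≠ midIdx l r := by
    intro i h1
    have := congrArg Fin.val h1
    simp at this
    omega
  have hr : ∀ j, rightIdx l r j ≠ midIdx l r := by
    intro j h1
    have := congrArg Fin.val h1
    simp at this
    omega
  -- Otherwise the two entries form a `132` with the maximum in the middle. Counting then forces the
  -- value intervals: `r` values lie below each left value, and `l` values lie between each right
  -- value and the maximum.
  have key : ∀ i j, (σ (rightIdx l r j) : ℕ) < σ (leftIdx l r i) := by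
    intro i j
    by_contra h1
    have h2 : (σ (rightIdx l r j) : ℕ) ≠ σ (leftIdx l r i) := fun h3 => by
      have := congrArg Fin.val (σ.injective (Fin.ext h3))
      simp at this
      omega
    have h4 := hlt _ (hr j)
    refine h (leftIdx l r i) (midIdx l r) (rightIdx l r j) ?_ ?_ ?_ ?_ <;>
      simp only [Fin.lt_def, val_leftIdx, val_midIdx, val_rightIdx] <;> omega
  refine ⟨fun i => ⟨?_, ?_⟩, hσ, fun j => ⟨Nat.zero_le _, ?_⟩⟩
  · have := Fintype.card_le_of_injective
      (fun j : Fin r => (⟨σ (rightIdx l r j), key i j⟩ : Fin (σ (leftIdx l r i)))) (by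
        intro j j' hj
        have hj := congrArg Fin.val hj
        exact rightIdx_injective (σ.injective (Fin.ext hj)))
    simpa using this
  · have := hlt _ (hl i)
    omega
  · have := Fintype.card_le_of_injective
      (fun i : Fin l => (⟨σ (leftIdx l r i) - σ (rightIdx l r j) - 1, by
        have := key i j
        have := hlt _ (hl i)
        omega⟩ : Fin (l + r - 1 - σ (rightIdx l r j)))) (by
        intro i i' hi
        have hi := congrArg Fin.val hi
        have := key i j
        have := key i' j
        simp only at hi
        exact leftIdx_injective (σ.injective (Fin.ext (by omega))))
    rw [Fintype.card_fin, Fintype.card_fin] at this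
    have := hlt _ (hr j)
    omega

/-- The number of entries of `σ` on the diagonal with offset `h`. -/
def diagCount {n : ℕ} (h : ℤ) (σ : Equiv.Perm (Fin n)) : ℕ :=
  ∑ i : Fin n, if ((i : ℕ) : ℤ) - ((σ i : ℕ) : ℤ) = h then 1 else 0

theorem diagCount_zero {n : ℕ} (σ : Equiv.Perm (Fin n)) : diagCount 0 σ = fp σ := by
  rw [diagCount, fp, card_filter]
  refine sum_congr rfl fun i _ => ?_
  congr 1
  rw [Fin.ext_iff, eq_iff_iff]
  omega

/-- The left values are raised by `r`, the right positions by `l + 1`, and the maximum has offset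
`-r`. These shifts are why a recursion for fixed points alone does not close up. -/
theorem diagCount_glue (h : ℤ) (α : Equiv.Perm (Fin l)) (β : Equiv.Perm (Fin r)) :
    diagCount h (glue (blockLayout132 l r) α β) =
      (if h = -r then 1 else 0) + diagCount (h + r) α + diagCount (h - l - 1) β := by
  rw [diagCount, sum_idx, ← add_assoc, add_comm (∑ i, _)]
  simp only [val_leftIdx, val_midIdx, val_rightIdx, glue_left, glue_mid, glue_right]
  congr 1
  · congr 1
    · congr 1
      rw [eq_iff_iff]
      push_cast
      omega
    · refine sum_congr rfl fun i _ => ?_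
      congr 1
      rw [eq_iff_iff]
      push_cast
      omega
  · refine sum_congr rfl fun i _ => ?_
    congr 1
    rw [eq_iff_iff]
    push_cast
    omega

variable {R : Type*} [CommRing R] (u : R)

open Classical in
/-- The generating polynomial of `132`-avoiding permutations by the number of entries on the
diagonal with offset `h`. -/
noncomputable def diagPoly (n : ℕ) (h : ℤ) : R :=
  ∑ σ : Equiv.Perm (Fin n) with Avoids132 σ, u ^ diagCount h σ

open Classical in
theorem sum_avoids132_max {n : ℕ} (h : ℤ) (hn : l + r = n) :
    ∑ σ : Equiv.Perm (Fin (n + 1)) with Avoids132 σ ∧ (σ.symm (Fin.last n) : ℕ) = l,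
      u ^ diagCount h σ =
    (if h = -r then u else 1) * diagPoly u l (h + r) * diagPoly u r (h - l - 1) := by
  subst hn
  have h1 : (univ.filter fun σ : Equiv.Perm (Fin (l + r + 1)) =>
      Avoids132 σ ∧ (σ.symm (Fin.last (l + r)) : ℕ) = l) =
      (univ.filter fun σ => RespectsBlocks r (l + r) 0 σ).filter fun σ => Avoids132 σ := by
    ext σ
    have h2 : (σ.symm (Fin.last (l + r)) : ℕ) = l ↔ (σ (midIdx l r) : ℕ) = l + r := by
      refine (Fin.ext_iff (b := midIdx l r)).symm.trans ((Equiv.symm_apply_eq σ).trans ?_)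
      rw [eq_comm, Fin.ext_iff, Fin.val_last]
    simp only [mem_filter, mem_univ, true_and, h2]
    exact ⟨fun h3 => ⟨h3.1.respectsBlocks h3.2, h3.1⟩, fun h3 => ⟨h3.2, h3.1.mid⟩⟩
  rw [h1, sum_filter, sum_respectsBlocks (blockLayout132 l r), diagPoly, diagPoly, mul_assoc,
    sum_mul_sum, mul_sum, sum_filter]
  refine sum_congr rfl fun α _ => ?_
  by_cases hα : Avoids132 α
  · rw [if_pos hα, mul_sum, sum_filter]
    refine sum_congr rfl fun β _ => ?_
    simp only [avoids132_glue, hα, true_and]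
    congr 1
    rw [diagCount_glue, pow_add, pow_add, mul_assoc]
    split_ifs <;> simp
  · rw [if_neg hα]
    refine sum_eq_zero fun β _ => ?_
    rw [avoids132_glue, if_neg (fun h => hα h.1)]

open Classical in
theorem diagPoly_succ (n : ℕ) (h : ℤ) :
    diagPoly u (n + 1) h = ∑ x ∈ antidiagonal n,
      (if h = -x.2 then u else 1) * diagPoly u x.1 (h + x.2) * diagPoly u x.2 (h - x.1 - 1) := by
  rw [diagPoly, ← sum_fiberwise_of_maps_to (t := antidiagonal n)
    (g := fun σ : Equiv.Perm (Fin (n + 1)) =>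
      ((σ.symm (Fin.last n) : ℕ), n - (σ.symm (Fin.last n) : ℕ)))]
  · refine sum_congr rfl fun x hx => ?_
    rw [HasAntidiagonal.mem_antidiagonal] at hx
    rw [← sum_avoids132_max u h hx, filter_filter]
    refine sum_congr (filter_congr fun σ _ => ?_) fun _ _ => rfl
    rw [Prod.ext_iff]
    simp only
    refine and_congr_right fun _ => ⟨fun h => h.1, fun h => ⟨h, by omega⟩⟩
  · intro σ _
    rw [HasAntidiagonal.mem_antidiagonal]
    simp only
    omega

theorem diagPoly_zero_left (h : ℤ) : diagPoly u 0 h = 1 := by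
  have h1 : ∀ σ : Equiv.Perm (Fin 0), Avoids132 σ := fun σ i => i.elim0
  simp [diagPoly, h1, diagCount]

theorem diagPoly_zero_eq (n : ℕ) :
    diagPoly u n 0 = ∑ k ∈ range (n + 1), (u - 1) ^ k * (ballot (n - k) k : R) := by
  refine eq_sum_ballot_of_recurrence (u - 1) (fun n => diagPoly u n 0)
    (diagPoly_zero_left u 0) (fun n => ?_) n
  -- At `h = 0` the cutoff in `catalanTail` is vacuous, leaving the plain Catalan convolution.
  rw [eq_catalan_add_catalanTail u (diagPoly u) (diagPoly_zero_left u) (diagPoly_succ u),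
    Nat.sum_antidiagonal_eq_sum_range_succ (fun i j => (catalan i : R) * diagPoly u j 0)]
  simp [catalanTail]

open Classical in
theorem sum_avoidingPerm {M : Type*} [AddCommMonoid M] {n m : ℕ} (τ : Equiv.Perm (Fin m))
    (W : Equiv.Perm (Fin n) → M) :
    ∑ σ : AvoidingPerm n τ, W σ.1 =
      ∑ σ : Equiv.Perm (Fin n) with ¬ ContainsPattern σ τ, W σ := by
  refine sum_bij (fun σ _ => σ.1) ?_ ?_ ?_ ?_
  · intro σ _
    simpa using σ.2
  · intro σ _ σ' _ h
    exact Subtype.ext h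
  · intro σ hσ
    exact ⟨⟨σ, (mem_filter.1 hσ).2⟩, mem_univ _, rfl⟩
  · intro σ _; rfl

theorem hasBallotExpansion_pattern132 :
    HasBallotExpansion fun n (σ : AvoidingPerm n pattern132) => fp σ.1 := by
  intro R _ u n
  rw [← diagPoly_zero_eq, sum_avoidingPerm pattern132 fun σ => u ^ fp σ, diagPoly]
  refine sum_congr ?_ fun σ _ => by rw [diagCount_zero]
  ext σ
  simp [not_containsPattern132_iff]

theorem hasBallotExpansion_pattern213 :
    HasBallotExpansion fun n (σ : AvoidingPerm n pattern213) => fp σ.1 := by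
  classical
  intro R _ u n
  rw [← hasBallotExpansion_pattern132 R u n, sum_avoidingPerm pattern132 fun σ => u ^ fp σ,
    sum_avoidingPerm pattern213 fun σ => u ^ fp σ, sum_filter, sum_filter,
    ← (reverseComplement n).sum_comp]
  simp only [← reverseComplement_pattern132, containsPattern_reverseComplement_iff,
    fp_reverseComplement]

end Decomposition
end FixedPointBiased

/-! ### Counting `321`-avoiders by first value, then splitting them at fixed points. -/

namespace FixedPointBiased
open Finset

section Insertion

variable {n : ℕ}

/-- The permutation with first value `v` whose remaining entries are order-isomorphic to `π`. -/
noncomputable def consPerm (v : Fin (n + 1)) (π : Equiv.Perm (Fin n)) :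
    Equiv.Perm (Fin (n + 1)) :=
  Equiv.ofBijective (Fin.cons v fun i => v.succAbove (π i)) <|
    Finite.injective_iff_bijective.1 <| Fin.cons_injective_iff.2
      ⟨by rintro ⟨i, hi⟩; exact Fin.succAbove_ne _ _ hi,
        Fin.succAbove_right_injective.comp π.injective⟩

@[simp] theorem consPerm_zero (v : Fin (n + 1)) (π : Equiv.Perm (Fin n)) :
    consPerm v π 0 = v := rfl

theorem consPerm_succ (v : Fin (n + 1)) (π : Equiv.Perm (Fin n)) (i : Fin n) :
    consPerm v π i.succ = v.succAbove (π i) := rfl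

theorem val_consPerm_succ (v : Fin (n + 1)) (π : Equiv.Perm (Fin n)) (i : Fin n) :
    (consPerm v π i.succ : ℕ) = if (π i : ℕ) < v then (π i : ℕ) else π i + 1 := by
  rw [consPerm_succ, Fin.succAbove]
  simp only [Fin.lt_def, Fin.val_castSucc]
  split_ifs <;> simp

theorem val_consPerm_zero_succ (π : Equiv.Perm (Fin n)) (i : Fin n) :
    (consPerm 0 π i.succ : ℕ) = π i + 1 := by
  rw [val_consPerm_succ, if_neg (by simp)]

theorem consPerm_bijective :
    Function.Bijective fun x : Fin (n + 1) × Equiv.Perm (Fin n) => consPerm x.1 x.2 := by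
  rw [Fintype.bijective_iff_injective_and_card]
  constructor
  · rintro ⟨v, π⟩ ⟨v', π'⟩ h
    simp only at h
    obtain rfl : v = v' := by
      rw [← consPerm_zero v π, h, consPerm_zero]
    congr 1
    ext i
    have h1 := congrArg (fun σ => σ i.succ) h
    simp only [consPerm_succ] at h1
    rw [Fin.succAbove_right_injective h1]
  · simp [Fintype.card_perm, Nat.factorial_succ]

theorem sum_consPerm {M : Type*} [AddCommMonoid M] (W : Equiv.Perm (Fin (n + 1)) → M) :
    ∑ σ, W σ = ∑ v, ∑ π, W (consPerm v π) := by
  rw [← Fintype.sum_prod_type', consPerm_bijective.sum_comp]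

/-- The values smaller than `k` appear in `σ` in increasing order. -/
def LowSorted (k : ℕ) (σ : Equiv.Perm (Fin n)) : Prop :=
  ∀ i j, σ i < σ j → (σ j : ℕ) < k → i < j

theorem lowSorted_zero (σ : Equiv.Perm (Fin n)) : LowSorted 0 σ :=
  fun _ _ _ h => absurd h (Nat.not_lt_zero _)

/-- A `321` that uses the first entry is a descending pair among the values below `v`. -/
theorem avoids321_consPerm (v : Fin (n + 1)) (π : Equiv.Perm (Fin n)) :
    Avoids321 (consPerm v π) ↔ Avoids321 π ∧ LowSorted v π := by
  constructor
  · intro h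
    constructor
    · intro i j k
      have := h i.succ j.succ k.succ
      simp only [Fin.lt_def, val_consPerm_succ, Fin.val_succ] at this ⊢
      split_ifs at this <;> omega
    · intro i j hij hj
      by_contra hc
      have hne : (i : ℕ) ≠ j := fun h1 => by
        rw [Fin.ext h1] at hij
        exact lt_irrefl _ hij
      have := h 0 j.succ i.succ
      simp only [Fin.lt_def, val_consPerm_succ, Fin.val_succ, consPerm_zero, Fin.val_zero]
        at this hij hc
      split_ifs at this <;> omega
  · rintro ⟨h1, h2⟩ i j k hij hjk
    obtain ⟨j, rfl⟩ := Fin.exists_succ_eq.2 (Fin.ne_zero_of_lt hij)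
    obtain ⟨k, rfl⟩ := Fin.exists_succ_eq.2 (Fin.ne_zero_of_lt hjk)
    cases i using Fin.cases with
    | zero =>
      have := h2 k j
      simp only [Fin.lt_def, val_consPerm_succ, Fin.val_succ, consPerm_zero] at this hjk ⊢
      split_ifs <;> omega
    | succ i =>
      have := h1 i j k
      simp only [Fin.lt_def, val_consPerm_succ, Fin.val_succ] at this hij hjk ⊢
      split_ifs <;> omega

theorem lowSorted_succ_consPerm_zero (k : ℕ) (π : Equiv.Perm (Fin n)) :
    LowSorted (k + 1) (consPerm 0 π) ↔ LowSorted k π := by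
  constructor
  · intro h i j
    have := h i.succ j.succ
    simp only [Fin.lt_def, val_consPerm_zero_succ, Fin.val_succ] at this ⊢
    omega
  · intro h i j hij hj
    cases j using Fin.cases with
    | zero => simp at hij
    | succ j =>
      cases i using Fin.cases with
      | zero => exact Fin.succ_pos j
      | succ i =>
        have := h i j
        simp only [Fin.lt_def, val_consPerm_zero_succ, Fin.val_succ] at this hij hj ⊢
        omega

theorem not_lowSorted_consPerm {k : ℕ} {v : Fin (n + 1)} (hv0 : (v : ℕ) ≠ 0) (hv : (v : ℕ) < k)
    (π : Equiv.Perm (Fin n)) : ¬ LowSorted k (consPerm v π) := by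
  intro h
  have := h ((consPerm v π).symm 0) 0
  simp only [Equiv.apply_symm_apply, consPerm_zero, Fin.not_lt_zero] at this
  exact this (Fin.pos_of_ne_zero fun h => hv0 (by simp [h])) hv

theorem lowSorted_consPerm_of_le {k : ℕ} {v : Fin (n + 1)} (hv : k ≤ (v : ℕ))
    {π : Equiv.Perm (Fin n)} (h : LowSorted v π) : LowSorted k (consPerm v π) := by
  intro i j hij hj
  cases j using Fin.cases with
  | zero => simp at hj; omega
  | succ j =>
    cases i using Fin.cases with
    | zero => exact Fin.succ_pos j
    | succ i =>
      have := h i j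
      simp only [Fin.lt_def, val_consPerm_succ, Fin.val_succ] at this hij hj ⊢
      split_ifs at hij hj <;> omega

open Classical in
/-- The number of `321`-avoiding permutations in which the values smaller than `k` appear in
increasing order. -/
noncomputable def lowSortedCount (n k : ℕ) : ℕ :=
  ∑ σ : Equiv.Perm (Fin n), if Avoids321 σ ∧ LowSorted k σ then 1 else 0

theorem lowSortedCount_succ_zero (n : ℕ) :
    lowSortedCount (n + 1) 0 = ∑ v ∈ Ico 0 (n + 1), lowSortedCount n v := by
  rw [lowSortedCount, sum_consPerm, ← range_eq_Ico, ← Fin.sum_univ_eq_sum_range]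
  refine sum_congr rfl fun v _ => sum_congr rfl fun π _ => ?_
  congr 1
  rw [eq_iff_iff, avoids321_consPerm]
  simp only [lowSorted_zero, and_true]

/-- A first value `v` with `0 < v ≤ k` precedes `0` and breaks sortedness; for `v > k` the condition
follows from avoidance. The case `v = 0` contributes `lowSortedCount n k`, which fills the slot `v =
k` of the sum. -/
theorem lowSortedCount_succ_succ {n k : ℕ} (hk : k ≤ n) :
    lowSortedCount (n + 1) (k + 1) = ∑ v ∈ Ico k (n + 1), lowSortedCount n v := by
  have h : ∀ v : Fin (n + 1), (∑ π : Equiv.Perm (Fin n),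
      open Classical in if Avoids321 (consPerm v π) ∧ LowSorted (k + 1) (consPerm v π)
        then 1 else 0) =
      (if (v : ℕ) = 0 then lowSortedCount n k else 0) +
        if k + 1 ≤ (v : ℕ) then lowSortedCount n v else 0 := by
    intro v
    by_cases hv0 : (v : ℕ) = 0
    · obtain rfl : v = 0 := Fin.ext hv0
      rw [if_pos hv0, if_neg (by omega), add_zero]
      refine sum_congr rfl fun π _ => ?_
      congr 1
      rw [eq_iff_iff, avoids321_consPerm, lowSorted_succ_consPerm_zero]
      simp [lowSorted_zero]
    · rw [if_neg hv0, zero_add]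
      by_cases hv : k + 1 ≤ (v : ℕ)
      · rw [if_pos hv]
        refine sum_congr rfl fun π _ => ?_
        congr 1
        rw [eq_iff_iff, avoids321_consPerm]
        exact ⟨fun h => h.1, fun h => ⟨h, lowSorted_consPerm_of_le hv h.2⟩⟩
      · rw [if_neg hv]
        exact sum_eq_zero fun π _ =>
          if_neg fun h => not_lowSorted_consPerm hv0 (by omega) π h.2
  rw [lowSortedCount, sum_consPerm, sum_congr rfl fun v _ => h v,
    Fin.sum_univ_eq_sum_range (fun v => (if v = 0 then lowSortedCount n k else 0) +
        if k + 1 ≤ v then lowSortedCount n v else 0) (n + 1), sum_add_distrib, sum_ite_eq',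
    if_pos (by simp), ← sum_filter, sum_eq_sum_Ico_succ_bot (show k < n + 1 by omega)]
  congr 2
  ext v
  simp only [mem_filter, mem_range, mem_Ico]
  omega

theorem lowSortedCount_eq_ballot {n k : ℕ} (hk : k ≤ n) :
    lowSortedCount n k = ballot (n - k) k := by
  induction n generalizing k with
  | zero =>
    obtain rfl : k = 0 := by omega
    have h : ∀ σ : Equiv.Perm (Fin 0), Avoids321 σ := fun σ i => i.elim0
    simp [lowSortedCount, ballot_zero_left, h, lowSorted_zero]
  | succ n ih =>
    have h : ∀ k, ∑ v ∈ Ico k (n + 1), lowSortedCount n v =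
        ∑ v ∈ Ico k (n + 1), ballot (n - v) v := fun k => sum_congr rfl fun v hv => by
      rw [mem_Ico] at hv
      exact ih (by omega)
    cases k with
    | zero =>
      rw [lowSortedCount_succ_zero, h, sum_Ico_ballot n 0 (by omega), Nat.sub_zero, Nat.sub_zero,
        ballot_succ_zero]
    | succ k =>
      rw [lowSortedCount_succ_succ (by omega), h, sum_Ico_ballot n k (by omega),
        Nat.add_sub_add_right]

-- Needed for both the constant term and the left factor in `fixPoly_succ`.
open Classical in
theorem card_avoids321 (n : ℕ) :
    (univ.filter fun σ : Equiv.Perm (Fin n) => Avoids321 σ).card = catalan n := by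
  have h := lowSortedCount_eq_ballot (Nat.zero_le n)
  rw [Nat.sub_zero, ballot_zero_right, lowSortedCount] at h
  rw [card_filter, ← h]
  simp only [lowSorted_zero, and_true]

end Insertion

section Decomposition

variable {l r : ℕ}

theorem blockLayout321 (l r : ℕ) : BlockLayout l r 0 l (l + 1) := by
  constructor <;> omega

theorem avoids321_glue (α : Equiv.Perm (Fin l)) (β : Equiv.Perm (Fin r)) :
    Avoids321 (glue (blockLayout321 l r) α β) ↔ Avoids321 α ∧ Avoids321 β := by
  constructor
  · intro h
    constructor
    · intro i j k
      have := h (leftIdx l r i) (leftIdx l r j) (leftIdx l r k)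
      simp only [Fin.lt_def, val_leftIdx, glue_left] at this ⊢
      omega
    · intro i j k
      have := h (rightIdx l r i) (rightIdx l r j) (rightIdx l r k)
      simp only [Fin.lt_def, val_rightIdx, glue_right] at this ⊢
      omega
  · rintro ⟨hα, hβ⟩ i j k
    induction i using idx_cases <;> induction j using idx_cases <;>
      induction k using idx_cases <;>
      simp only [Fin.lt_def, val_leftIdx, val_midIdx, val_rightIdx, glue_left, glue_mid,
        glue_right] <;> try omega
    · rename_i i j k
      have := hα i j k
      simp only [Fin.lt_def] at this
      omega
    · rename_i i j k
      have := hβ i j k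
      simp only [Fin.lt_def] at this
      omega

theorem Avoids321.respectsBlocks {σ : Equiv.Perm (Fin (l + r + 1))} (h : Avoids321 σ)
    (hσ : (σ (midIdx l r) : ℕ) = l) : RespectsBlocks 0 l (l + 1) σ := by
  have hval : ∀ x y, (σ x : ℕ) = σ y → (x : ℕ) = y := fun x y hxy =>
    congrArg Fin.val (σ.injective (Fin.ext hxy))
  have hr : ∀ j, (σ (rightIdx l r j) : ℕ) ≠ l := by
    intro j h1
    have := hval _ _ (h1.trans hσ.symm)
    simp at this
    omega
  have hl : ∀ i, (σ (leftIdx l r i) : ℕ) ≠ l := by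
    intro i h1
    have := hval _ _ (h1.trans hσ.symm)
    simp at this
    omega
  -- A left value above `l`, the fixed point and a right value below `l` would form a `321`. So the
  -- right values would exhaust those above `l`, leaving none for the left entry.
  have left : ∀ i, (σ (leftIdx l r i) : ℕ) < l := by
    intro i
    by_contra h1
    have h2 := hl i
    have h3 : ∀ j, l + 1 ≤ (σ (rightIdx l r j) : ℕ) := by
      intro j
      have := h (leftIdx l r i) (midIdx l r) (rightIdx l r j)
      have := hr j
      simp only [Fin.lt_def, val_leftIdx, val_midIdx, val_rightIdx] at *
      omega
    have h4 : Function.Injective fun j : Fin r =>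
        (⟨σ (rightIdx l r j) - (l + 1), by have := h3 j; omega⟩ : Fin r) := by
      intro j j' hj
      have hj := congrArg Fin.val hj
      have := h3 j
      have := h3 j'
      simp only at hj
      exact rightIdx_injective (σ.injective (Fin.ext (by omega)))
    obtain ⟨j, hj⟩ := Finite.surjective_of_injective h4
      ⟨σ (leftIdx l r i) - (l + 1), by omega⟩
    have hj := congrArg Fin.val hj
    have := h3 j
    simp only at hj
    have := hval (rightIdx l r j) (leftIdx l r i) (by omega)
    simp at this
    omega
  refine ⟨fun i => ⟨Nat.zero_le _, by have := left i; omega⟩, hσ, fun j => ⟨?_, by omega⟩⟩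
  by_contra h1
  -- The left values exhaust those below `l`, so no right value can be there.
  have h4 : Function.Injective fun i : Fin l => (⟨σ (leftIdx l r i), left i⟩ : Fin l) := by
    intro i i' hi
    have hi := congrArg Fin.val hi
    exact leftIdx_injective (σ.injective (Fin.ext hi))
  obtain ⟨i, hi⟩ := Finite.surjective_of_injective h4
    ⟨σ (rightIdx l r j), by have := hr j; omega⟩
  have := hval (leftIdx l r i) (rightIdx l r j) (by simpa using congrArg Fin.val hi)
  simp at this
  omega

variable {R : Type*} [CommRing R] (u : R)

/-- A geometric sum indexed by the elements of `s`: the exponents run over `0, …, s.card - 1`.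
Applied to the set of fixed points, it marks one and weights only those after it. -/
theorem pow_card_sub_one {ι : Type*} [LinearOrder ι] (s : Finset ι) :
    u ^ s.card - 1 = (u - 1) * ∑ i ∈ s, u ^ (s.filter fun j => i < j).card := by
  induction s using Finset.induction_on_min with
  | empty => simp
  | insert a s ha ih =>
    have has : a ∉ s := fun h => lt_irrefl _ (ha a h)
    rw [card_insert_of_notMem has, sum_insert has, filter_insert, if_neg (lt_irrefl a),
      filter_true_of_mem ha, mul_add]
    have : ∀ i ∈ s, u ^ ((insert a s).filter fun j => i < j).card =
        u ^ (s.filter fun j => i < j).card := fun i hi => by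
      rw [filter_insert, if_neg (ha i hi).not_gt]
    rw [sum_congr rfl this, ← ih]
    ring

/-- The number of fixed points of `σ` after position `i`. -/
def fpAfter {n : ℕ} (i : Fin n) (σ : Equiv.Perm (Fin n)) : ℕ :=
  ((univ.filter fun j => σ j = j).filter fun j => i < j).card

theorem fpAfter_midIdx_glue (α : Equiv.Perm (Fin l)) (β : Equiv.Perm (Fin r)) :
    fpAfter (midIdx l r) (glue (blockLayout321 l r) α β) = fp β := by
  rw [fpAfter, fp, filter_filter, card_filter, card_filter, sum_idx]
  simp only [Fin.lt_def, Fin.ext_iff, val_leftIdx, val_midIdx, val_rightIdx, glue_left, glue_mid,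
    glue_right]
  rw [if_neg (by omega), zero_add, sum_eq_zero fun i _ => if_neg (by omega), zero_add]
  refine sum_congr rfl fun j _ => ?_
  congr 1
  rw [eq_iff_iff]
  omega

open Classical in
/-- The generating polynomial of `321`-avoiding permutations by the number of fixed points. -/
noncomputable def fixPoly (n : ℕ) : R :=
  ∑ σ : Equiv.Perm (Fin n) with Avoids321 σ, u ^ fp σ

open Classical in
theorem sum_avoids321_fixed {n : ℕ} (i : Fin (n + 1)) (hi : (i : ℕ) = l) (hn : l + r = n) :
    ∑ σ : Equiv.Perm (Fin (n + 1)) with Avoids321 σ ∧ σ i = i, u ^ fpAfter i σ =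
      (catalan l : R) * fixPoly u r := by
  subst hn
  obtain rfl : i = midIdx l r := Fin.ext hi
  have h1 : (univ.filter fun σ : Equiv.Perm (Fin (l + r + 1)) =>
      Avoids321 σ ∧ σ (midIdx l r) = midIdx l r) =
      (univ.filter fun σ => RespectsBlocks 0 l (l + 1) σ).filter fun σ => Avoids321 σ := by
    ext σ
    simp only [mem_filter, mem_univ, true_and]
    exact ⟨fun h => ⟨h.1.respectsBlocks (congrArg Fin.val h.2), h.1⟩,
      fun h => ⟨h.2, Fin.ext h.1.mid⟩⟩
  rw [h1, sum_filter, sum_respectsBlocks (blockLayout321 l r), ← card_avoids321, fixPoly,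
    ← nsmul_eq_mul, ← sum_const, sum_filter]
  refine sum_congr rfl fun α _ => ?_
  by_cases hα : Avoids321 α
  · rw [if_pos hα, sum_filter]
    simp only [avoids321_glue, hα, true_and, fpAfter_midIdx_glue]
  · rw [if_neg hα]
    refine sum_eq_zero fun β _ => ?_
    rw [avoids321_glue, if_neg fun h => hα h.1]

/-- Subtract the count of avoiders, mark a fixed point in each and exchange sums. The part before
the mark is an unweighted avoider, giving a Catalan number; the part after it keeps its full weight.
-/
theorem fixPoly_succ (n : ℕ) :
    fixPoly u (n + 1) = catalan (n + 1) +
      (u - 1) * ∑ x ∈ antidiagonal n, (catalan x.1 : R) * fixPoly u x.2 := by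
  classical
  rw [← sub_eq_iff_eq_add', ← card_avoids321, fixPoly, card_eq_sum_ones]
  push_cast
  rw [← sum_sub_distrib]
  have h : ∀ σ : Equiv.Perm (Fin (n + 1)), u ^ fp σ - 1 =
      (u - 1) * ∑ i, if σ i = i then u ^ fpAfter i σ else 0 := fun σ => by
    rw [fp, pow_card_sub_one, sum_filter]
    rfl
  simp only [h]
  rw [← mul_sum, sum_comm, Nat.sum_antidiagonal_eq_sum_range_succ
    (fun i j => (catalan i : R) * fixPoly u j), ← Fin.sum_univ_eq_sum_range
    (fun i => (catalan i : R) * fixPoly u (n - i))]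
  congr 1
  refine sum_congr rfl fun i _ => ?_
  rw [← sum_avoids321_fixed u i rfl (by omega), ← sum_filter, filter_filter]

theorem hasBallotExpansion_pattern321 :
    HasBallotExpansion fun n (σ : AvoidingPerm n pattern321) => fp σ.1 := by
  classical
  intro R _ u n
  have h0 : fixPoly u 0 = 1 := by
    have h1 : ∀ σ : Equiv.Perm (Fin 0), Avoids321 σ := fun σ i => i.elim0
    simp [fixPoly, h1, fp]
  rw [← eq_sum_ballot_of_recurrence (u - 1) (fixPoly u) h0 (fixPoly_succ u),
    sum_avoidingPerm pattern321 fun σ => u ^ fp σ, fixPoly]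
  refine sum_congr ?_ fun _ _ => rfl
  ext σ
  simp [not_containsPattern321_iff]

end Decomposition
end FixedPointBiased

theorem theorem3 (q : ℝ) (hq0 : 0 < q) (hq3 : q < 3) (τ : Equiv.Perm (Fin 3))
    (hτ : τ = FixedPointBiased.pattern132 ∨ τ = FixedPointBiased.pattern321 ∨
      τ = FixedPointBiased.pattern213) :
    MeasureTheory.TendstoInDistribution
      (fun (n : ℕ) (σ : FixedPointBiased.AvoidingPerm n τ) => (FixedPointBiased.fp σ.1 : ℝ))
      Filter.atTop
      (fun k : ℕ => (k : ℝ))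
      (fun n : ℕ => (FixedPointBiased.biasedPMF n q hq0 (by norm_num) τ).toMeasure)
      (FixedPointBiased.negativeBinomialPMF 2 (by norm_num) (1 - q / 3)
        (by linarith) (by linarith)).toMeasure := by
  refine FixedPointBiased.tendstoInDistribution_of_hasBallotExpansion _ τ ?_ q hq0 hq3
  rcases hτ with rfl | rfl | rfl
  · exact FixedPointBiased.hasBallotExpansion_pattern132
  · exact FixedPointBiased.hasBallotExpansion_pattern321
  · exact FixedPointBiased.hasBallotExpansion_pattern213
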